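/- Let $\mathcal V$ be a real inner product space with norm $\|\cdot\|$, and let $B(x,r)$ denote the open ball in $\mathcal V$ with centre $x$ and radius $r$. For $A\subseteq\mathcal V$ let $\operatorname{dom}(P_A)$ be the set of all $x\in\mathcal V$ that have exactly one nearest point in $A$. For $v \in A$ let the local reach of $A$ at $v$ be $$\operatorname{rch}(A,v):=\sup\{r\ge 0 : B(v,r)\subseteq\operatorname{dom}(P_A)\}\in[0,\infty].$$ Let $\mathcal N\subseteq\mathcal V$ be contained in a finite-dimensional linear subspace of $\mathcal V$ and be an embedded $C^1$ submanifold (without boundary) of some dimension $d\ge 0$. Let $u\in\mathcal N$, and let $\mathbb T_u\mathcal N$ be the tangent space of $\mathcal N$ at $u$, i.e. the set of velocities $\gamma'(0)$ of $C^1$ curves $\gamma$ in $\mathcal N$ with $\gamma(0)=u$. Assume that $R:=\operatorname{rch}(\mathcal N,u)>0$; the value $R=\infty$ is allowed, with $\frac{c}{2\cdot\infty}:=0$ for real $c$. Then there exists a real number $r^\ast$ with $0<r^\ast\le R$ such that the following two statements hold. 1. For all $r\in(0,\infty)$ and every $v\in\mathcal N\cap B(u,r)$ there exists $w\in(u+\mathbb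 T_u\mathcal N)\cap B(u,r)$ with $\|v-w\|\le\frac{\|u-v\|^2}{2R}$. 2. For all $r\in(0,r^\ast)$ and every $w\in(u+\mathbb T_u\mathcal N)\cap B(u,r)$ there exists $v\in\mathcal N\cap B(u,r)$ with $\|w-v\|\le\frac{\|u-w\|^2}{2R}$. -/

import Mathlib

open Set Topology
open scoped ENNReal NNReal

/-- The domain of the best approximation operator `P_A`: the points of the ambient space that have
exactly one nearest point in `A`. -/
def bestApproxDomain {V : Type*} [NormedAddCommGroup V] (A : Set V) : Set V :=
  {x | ∃! a, a ∈ A ∧ ∀ b ∈ A, ‖x - a‖ ≤ ‖x - b‖}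

/-- The local reach of `A` at `v`, with values in `[0, ∞]`: the supremum of all real `r ≥ 0` such
that every point of the open ball `B(v, r)` has a unique nearest point in `A`. -/
noncomputable def localReach {V : Type*} [NormedAddCommGroup V] (A : Set V) (v : V) : ℝ≥0∞ :=
  sSup {R : ℝ≥0∞ | ∃ r : ℝ≥0, R = r ∧ Metric.ball v (r : ℝ) ⊆ bestApproxDomain A}

/-- `N` is an (embedded, boundaryless) `d`-dimensional `C¹` submanifold of `V`: near each of its
points it is the image of an open subset of `ℝ^d` under a `C¹` map that is an immersion and a
homeomorphism onto its image. -/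
def IsC1Submanifold {V : Type*} [NormedAddCommGroup V] [NormedSpace ℝ V]
    (d : ℕ) (N : Set V) : Prop :=
  ∀ x ∈ N, ∃ (W : Set V) (Ω : Set (EuclideanSpace ℝ (Fin d)))
    (φ : EuclideanSpace ℝ (Fin d) → V),
    IsOpen W ∧ x ∈ W ∧ IsOpen Ω ∧
    ContDiffOn ℝ 1 φ Ω ∧
    (∀ p ∈ Ω, Function.Injective (fderiv ℝ φ p)) ∧
    IsEmbedding (Ω.domRestrict φ) ∧
    φ '' Ω = N ∩ W

/-- The tangent space `T_u N`: the set of all velocities at time `0` of `C¹` curves in `N` that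
pass through `u` at time `0`. -/
def tangentSpaceAt {V : Type*} [NormedAddCommGroup V] [NormedSpace ℝ V]
    (N : Set V) (u : V) : Set V :=
  {h | ∃ γ : ℝ → V, γ 0 = u ∧ (∀ᶠ t in 𝓝 (0 : ℝ), γ t ∈ N) ∧
    ContDiffAt ℝ 1 γ 0 ∧ HasDerivAt γ h 0}

/-- The affine tangent space `u + T_u N`. -/
def affineTangentSpaceAt {V : Type*} [NormedAddCommGroup V] [NormedSpace ℝ V]
    (N : Set V) (u : V) : Set V :=
  (fun h => u + h) '' tangentSpaceAt N u

/-! The core is one bound: for `v` in `N`, the component `k` of `v - u` orthogonal to the tangent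
space `T` satisfies 2R‖k‖ ≤ ‖v - u‖². It says that open balls of radius `s` < R inside `E`, tangent
to `N` at `u`, miss `N` (`le_norm_add_smul_sub`). The reason is Federer's principle
`IsNearest.add_smul`: within the reach, a nearest point stays nearest when the base point moves
straight away from it. For a unit normal `n`, the nearest point of u + εn is u + o(ε); pushing away
from it by `s` and letting ε → 0 gives the tangent ball.

Statement 1 follows by projecting orthogonally onto u + T. For statement 2, `N` projects locally
onto u + T, but the point of `N` over w = u + h may leave the ball and be farther than ‖h‖²/(2R). A
point over a slightly shortened `h` does better; `sq_add_sq_le_of_two_mul_le` is the planar estimate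
behind this. -/

/-! ### Nearest points within the reach. -/

section NearestPoint

variable {F : Type*} [NormedAddCommGroup F]

/-- `q` is a nearest point of `x` in `A`. -/
def IsNearest (A : Set F) (x q : F) : Prop :=
  q ∈ A ∧ ∀ b ∈ A, ‖x - q‖ ≤ ‖x - b‖

lemma IsNearest.infDist_eq {A : Set F} {x q : F} (h : IsNearest A x q) :
    Metric.infDist x A = ‖x - q‖ := by
  apply le_antisymm
  · rw [← dist_eq_norm]
    exact Metric.infDist_le_dist_of_mem h.1
  · rw [Metric.le_infDist ⟨q, h.1⟩]
    intro b hb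
    rw [dist_eq_norm]
    exact h.2 b hb

variable [InnerProductSpace ℝ F]

/-- A point `y` at distance `infDist z A` from `z` in the closure of `A` is the nearest point of
`z` as soon as the points near `z` have nearest points. -/
lemma eq_of_mem_closure_of_norm_le {A : Set F} {u z q y : F} {ρ : ℝ}
    (hA : Metric.ball u ρ ⊆ bestApproxDomain A) (hz : z ∈ Metric.ball u ρ)
    (hq : IsNearest A z q) (hy : y ∈ closure A) (hyz : ‖z - y‖ ≤ ‖z - q‖) : y = q := by
  set D := ‖z - q‖ with hD
  have hyD : ‖z - y‖ = D := by
    apply le_antisymm hyz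
    rw [hD, ← hq.infDist_eq, ← Metric.infDist_closure, ← dist_eq_norm]
    exact Metric.infDist_le_dist_of_mem hy
  -- `A` need not be closed, so uniqueness says nothing about `y` directly. Instead, step slightly
  -- from `z` towards `y`: the nearest point `a` there is, by the triangle inequality, also nearest
  -- to `z`, so it is `q`. The equality case then forces `y = q`.
  have hev : ∀ᶠ t in 𝓝[>] (0 : ℝ), z + t • (y - z) ∈ Metric.ball u ρ := by
    have hc : Continuous fun t : ℝ => z + t • (y - z) := by fun_prop
    have h0 : Metric.ball u ρ ∈ 𝓝 (z + (0 : ℝ) • (y - z)) := by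
      simpa using Metric.isOpen_ball.mem_nhds hz
    exact nhdsWithin_le_nhds (hc.continuousAt.preimage_mem_nhds h0)
  obtain ⟨t, ⟨ht, ht1⟩, ht0⟩ :=
    ((hev.and (nhdsWithin_le_nhds (Iio_mem_nhds (zero_lt_one' ℝ)))).and
      self_mem_nhdsWithin).exists
  have ht1 : t < 1 := ht1
  have ht0 : 0 < t := ht0
  obtain ⟨a, ha, -⟩ := hA ht
  have ha : IsNearest A _ a := ha
  have hta : ‖z + t • (y - z) - a‖ ≤ (1 - t) * D := by
    rw [← ha.infDist_eq, ← Metric.infDist_closure]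
    refine (Metric.infDist_le_dist_of_mem hy).trans ?_
    have : z + t • (y - z) - y = (1 - t) • (z - y) := by module
    rw [dist_eq_norm, this, norm_smul, hyD, Real.norm_of_nonneg (by linarith)]
  have hza : ‖z - a‖ ≤ D := by
    have : z - a = t • (z - y) + (z + t • (y - z) - a) := by module
    rw [this]
    refine (norm_add_le _ _).trans ?_
    rw [norm_smul, hyD, Real.norm_of_nonneg ht0.le]
    linarith
  have haq : a = q := by
    obtain ⟨_, -, huniq⟩ := hA hz
    rw [huniq a ⟨ha.1, fun b hb => hza.trans (hq.2 b hb)⟩, huniq q hq]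
  subst haq
  have e1 : ‖z + t • (y - z) - a‖ ^ 2 = D ^ 2 - 2 * t * inner ℝ (z - a) (z - y) + t ^ 2 * D ^ 2 := by
    have : z + t • (y - z) - a = (z - a) - t • (z - y) := by module
    rw [this, norm_sub_sq_real, inner_smul_right, norm_smul, hyD, mul_pow, Real.norm_eq_abs,
      sq_abs]
    ring
  have e2 : ‖z + t • (y - z) - a‖ ^ 2 ≤ ((1 - t) * D) ^ 2 := by gcongr
  have e3 : D ^ 2 ≤ inner ℝ (z - a) (z - y) := by
    have : 2 * t * D ^ 2 ≤ 2 * t * inner ℝ (z - a) (z - y) := by nlinarith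
    exact le_of_mul_le_mul_left this (by positivity)
  have e4 : ‖(z - a) - (z - y)‖ ^ 2 ≤ 0 := by
    rw [norm_sub_sq_real, hyD]
    linarith
  have e5 : ‖(z - a) - (z - y)‖ = 0 := by
    have := sq_nonneg ‖(z - a) - (z - y)‖
    exact pow_eq_zero_iff (two_ne_zero) |>.1 (le_antisymm e4 this)
  rw [norm_eq_zero] at e5
  rw [← sub_eq_zero, ← e5]
  abel

variable [ProperSpace F]

/-- Nearest points depend continuously on the point. -/
lemma tendsto_of_isNearest {A : Set F} {u z q : F} {ρ : ℝ}
    (hA : Metric.ball u ρ ⊆ bestApproxDomain A) (hz : z ∈ Metric.ball u ρ)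
    (hq : IsNearest A z q) {P : F → F} (hP : ∀ᶠ x in 𝓝 z, IsNearest A x (P x)) :
    Filter.Tendsto P (𝓝 z) (𝓝 q) := by
  have hbound : ∀ ε > 0, ∀ᶠ x in 𝓝 z, P x ∈ Metric.closedBall z (‖z - q‖ + ε) := by
    intro ε hε
    filter_upwards [hP, Metric.ball_mem_nhds z (half_pos hε)] with x hx hxz
    rw [Metric.mem_ball, dist_eq_norm] at hxz
    rw [Metric.mem_closedBall', dist_eq_norm]
    have h1 : ‖x - q‖ ≤ ‖x - z‖ + ‖z - q‖ := norm_sub_le_norm_sub_add_norm_sub _ _ _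
    have h2 : ‖z - P x‖ ≤ ‖z - x‖ + ‖x - P x‖ := norm_sub_le_norm_sub_add_norm_sub _ _ _
    have h3 := hx.2 q hq.1
    rw [norm_sub_rev z x] at h2
    linarith
  refine (isCompact_closedBall z (‖z - q‖ + 1)).tendsto_nhds_of_unique_mapClusterPt
    (hbound 1 one_pos) fun y _ hy => ?_
  have hyA : y ∈ closure A := by
    rw [mem_closure_iff_clusterPt]
    exact ClusterPt.mono hy (Filter.le_principal_iff.2 (hP.mono fun x hx => hx.1))
  refine eq_of_mem_closure_of_norm_le hA hz hq hyA (le_of_forall_pos_le_add fun ε hε => ?_)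
  have : y ∈ Metric.closedBall z (‖z - q‖ + ε) := by
    rw [← Metric.isClosed_closedBall.closure_eq, mem_closure_iff_clusterPt]
    exact ClusterPt.mono hy (Filter.le_principal_iff.2 (hbound ε hε))
  rwa [Metric.mem_closedBall', dist_eq_norm] at this

/-- The distance to `A` grows at unit rate when moving away from the nearest point. -/
lemma eventually_lt_infDist {A : Set F} {u z q : F} {ρ c : ℝ}
    (hA : Metric.ball u ρ ⊆ bestApproxDomain A) (hz : z ∈ Metric.ball u ρ)
    (hq : IsNearest A z q) (hzq : z ≠ q) (hc0 : 0 ≤ c) (hc : c < 1) :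
    ∀ᶠ h in 𝓝[>] (0 : ℝ), Metric.infDist z A + c * h <
      Metric.infDist (z + h • ‖z - q‖⁻¹ • (z - q)) A := by
  set D := ‖z - q‖ with hD
  have hD0 : 0 < D := norm_pos_iff.2 (sub_ne_zero.2 hzq)
  set v := D⁻¹ • (z - q) with hv
  have hv1 : ‖v‖ = 1 := by
    rw [hv, norm_smul, norm_inv, norm_norm, ← hD, inv_mul_cancel₀ hD0.ne']
  choose! P hP using fun x (hx : x ∈ Metric.ball u ρ) => (hA hx).exists
  have hPev : ∀ᶠ x in 𝓝 z, IsNearest A x (P x) :=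
    Filter.eventually_of_mem (Metric.isOpen_ball.mem_nhds hz) fun x hx => hP x hx
  have hlim := tendsto_of_isNearest hA hz hq hPev
  have hpath : Filter.Tendsto (fun h : ℝ => z + h • v) (𝓝[>] 0) (𝓝 z) := by
    have hcont : Continuous fun h : ℝ => z + h • v := by fun_prop
    have := hcont.tendsto 0
    simp only [zero_smul, add_zero] at this
    exact this.mono_left nhdsWithin_le_nhds
  have hinner : Filter.Tendsto (fun h : ℝ => inner ℝ v (z - P (z + h • v))) (𝓝[>] 0)
      (𝓝 (inner ℝ v (z - q))) :=
    tendsto_const_nhds.inner (tendsto_const_nhds.sub (hlim.comp hpath))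
  have hvD : inner ℝ v (z - q) = D := by
    rw [hv, real_inner_smul_left, real_inner_self_eq_norm_sq, ← hD]
    field_simp
  rw [hvD] at hinner
  have hcD : c * D < D := by nlinarith
  filter_upwards [hinner.eventually_const_lt hcD, hpath.eventually hPev, self_mem_nhdsWithin]
    with h h1 h2 h0
  have h0 : 0 < h := h0
  rw [hq.infDist_eq, h2.infDist_eq, ← hD]
  -- As `h → 0` the inner product tends to `D`, so it eventually exceeds `c * D`; the right side is
  -- then larger than `(D + c * h) ^ 2`.
  have hexp : ‖z + h • v - P (z + h • v)‖ ^ 2 = ‖z - P (z + h • v)‖ ^ 2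
      + 2 * h * inner ℝ v (z - P (z + h • v)) + h ^ 2 := by
    have : z + h • v - P (z + h • v) = (z - P (z + h • v)) + h • v := by abel
    rw [this, norm_add_sq_real, inner_smul_right, norm_smul, hv1, real_inner_comm, mul_one,
      Real.norm_eq_abs, sq_abs]
    ring
  have hDle : D ^ 2 ≤ ‖z - P (z + h • v)‖ ^ 2 := by
    gcongr
    exact hq.2 _ h2.1
  refine lt_of_pow_lt_pow_left₀ 2 (norm_nonneg _) ?_
  rw [hexp]
  have h3 : 2 * h * (c * D) < 2 * h * inner ℝ v (z - P (z + h • v)) := by gcongr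
  have h4 : (c * h) ^ 2 ≤ h ^ 2 := by
    gcongr
    nlinarith
  nlinarith

/-- If the closed ball `B(x, s)` is contained in a ball of points with a unique nearest point in
`A`, then the nearest point of `x` remains nearest when moving away from it by `s`. -/
theorem IsNearest.add_smul {A : Set F} {u x p : F} {ρ s : ℝ}
    (hA : Metric.ball u ρ ⊆ bestApproxDomain A) (hs : 0 ≤ s)
    (hx : Metric.closedBall x s ⊆ Metric.ball u ρ) (hp : IsNearest A x p) (hxp : x ≠ p) :
    IsNearest A (x + s • ‖x - p‖⁻¹ • (x - p)) p := by
  set D := ‖x - p‖ with hD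
  have hD0 : 0 < D := norm_pos_iff.2 (sub_ne_zero.2 hxp)
  have hcont : Continuous fun y => Metric.infDist y A := Metric.continuous_infDist_pt A
  have hne : (Metric.closedBall x s).Nonempty := Metric.nonempty_closedBall.2 hs
  obtain ⟨y, hy, hymax⟩ :=
    (isCompact_closedBall x s).exists_isMaxOn hne hcont.continuousOn
  have hgrow : ∀ c : ℝ, 0 ≤ c → c < 1 → D + c * s ≤ Metric.infDist y A := by
    intro c hc0 hc1
    -- Penalised maximum: an interior maximiser could be improved by moving away from its nearest
    -- point, where the distance grows faster than `c`. So the maximiser lies on the sphere of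
    -- radius `s`.
    obtain ⟨z, hz, hzmax⟩ := (isCompact_closedBall x s).exists_isMaxOn hne
      (f := fun z => Metric.infDist z A - c * ‖z - x‖) (by fun_prop)
    have hzx : D ≤ Metric.infDist z A - c * ‖z - x‖ := by
      have := hzmax (Metric.mem_closedBall_self hs)
      simpa [hp.infDist_eq] using this
    have hzs : ‖z - x‖ = s := by
      rw [Metric.mem_closedBall, dist_eq_norm] at hz
      refine le_antisymm hz (not_lt.1 fun hlt => ?_)
      have hzb : z ∈ Metric.ball u ρ := hx (by rwa [Metric.mem_closedBall, dist_eq_norm])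
      obtain ⟨q, hq, -⟩ := hA hzb
      have hq : IsNearest A z q := hq
      have hzq : z ≠ q := by
        rintro rfl
        have := hq.infDist_eq
        rw [sub_self, norm_zero] at this
        have := mul_nonneg hc0 (norm_nonneg (z - x))
        linarith
      have hsmall : ∀ᶠ h in 𝓝[>] (0 : ℝ), h < s - ‖z - x‖ :=
        nhdsWithin_le_nhds (Iio_mem_nhds (by linarith))
      obtain ⟨h, ⟨h1, h2⟩, h0⟩ := (((eventually_lt_infDist hA hzb hq hzq hc0 hc1).and hsmall).and
        self_mem_nhdsWithin).exists
      have h0 : 0 < h := h0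
      set v := ‖z - q‖⁻¹ • (z - q) with hv
      have hv1 : ‖v‖ = 1 := by
        rw [hv, norm_smul, norm_inv, norm_norm,
          inv_mul_cancel₀ (norm_pos_iff.2 (sub_ne_zero.2 hzq)).ne']
      have hn : ‖z + h • v - x‖ ≤ ‖z - x‖ + h := by
        have : z + h • v - x = (z - x) + h • v := by abel
        rw [this]
        refine (norm_add_le _ _).trans ?_
        rw [norm_smul, hv1, mul_one, Real.norm_of_nonneg h0.le]
      have hmem : z + h • v ∈ Metric.closedBall x s := by
        rw [Metric.mem_closedBall, dist_eq_norm]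
        linarith
      have hle : Metric.infDist (z + h • v) A - c * ‖z + h • v - x‖
          ≤ Metric.infDist z A - c * ‖z - x‖ := hzmax hmem
      have := mul_le_mul_of_nonneg_left hn hc0
      linarith
    have : Metric.infDist z A ≤ Metric.infDist y A := hymax hz
    rw [hzs] at hzx
    linarith
  have hDs : D + s ≤ Metric.infDist y A := by
    have hlim : Filter.Tendsto (fun c : ℝ => D + c * s) (𝓝[<] 1) (𝓝 (D + s)) := by
      have hc : Continuous fun c : ℝ => D + c * s := by fun_prop
      have := hc.tendsto 1
      rw [one_mul] at this
      exact this.mono_left nhdsWithin_le_nhds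
    refine le_of_tendsto hlim ?_
    filter_upwards [self_mem_nhdsWithin, nhdsWithin_le_nhds (Ioi_mem_nhds (zero_lt_one' ℝ))]
      with c h1 h0
    exact hgrow c (le_of_lt h0) h1
  rw [Metric.mem_closedBall, dist_eq_norm] at hy
  have hyp : D + s ≤ ‖y - p‖ := by
    refine hDs.trans ?_
    rw [← dist_eq_norm]
    exact Metric.infDist_le_dist_of_mem hp.1
  -- `y` is within `s` of `x` but at least `D + s` from `p`: equality in the triangle inequality
  -- identifies `y`.
  have hinner : s * D ≤ inner ℝ (y - x) (x - p) := by
    have e1 : ‖y - p‖ ^ 2 = ‖y - x‖ ^ 2 + 2 * inner ℝ (y - x) (x - p) + D ^ 2 := by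
      rw [← sub_add_sub_cancel y x p, norm_add_sq_real]
    have e2 : (D + s) ^ 2 ≤ ‖y - p‖ ^ 2 := by gcongr
    have e3 : ‖y - x‖ ^ 2 ≤ s ^ 2 := by gcongr
    nlinarith
  have hyx : y - x = s • D⁻¹ • (x - p) := by
    have e1 : ‖(y - x) - s • D⁻¹ • (x - p)‖ ^ 2 ≤ 0 := by
      rw [norm_sub_sq_real, inner_smul_right, inner_smul_right, norm_smul, norm_smul, norm_inv,
        ← hD, Real.norm_of_nonneg hs, Real.norm_of_nonneg hD0.le, inv_mul_cancel₀ hD0.ne', mul_one]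
      have e2 : s * (D⁻¹ * (s * D)) ≤ s * (D⁻¹ * inner ℝ (y - x) (x - p)) := by gcongr
      have e3 : s * (D⁻¹ * (s * D)) = s ^ 2 := by field_simp
      have e4 : ‖y - x‖ ^ 2 ≤ s ^ 2 := by gcongr
      linarith
    have := pow_eq_zero_iff two_ne_zero |>.1 (le_antisymm e1 (sq_nonneg _))
    rwa [norm_eq_zero, sub_eq_zero] at this
  have hyeq : x + s • D⁻¹ • (x - p) = y := by rw [← hyx]; abel
  rw [hyeq]
  refine ⟨hp.1, fun b hb => ?_⟩
  have h1 : ‖y - p‖ ≤ s + D :=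
    (norm_sub_le_norm_sub_add_norm_sub y x p).trans (by linarith)
  have h2 : Metric.infDist y A ≤ ‖y - b‖ := by
    rw [← dist_eq_norm]
    exact Metric.infDist_le_dist_of_mem hb
  linarith

end NearestPoint

/-! ### First-order geometry of the submanifold. -/

section TangentSpace

variable {V : Type*} [NormedAddCommGroup V] [InnerProductSpace ℝ V]

open Asymptotics in
/-- If `N` is differentiable at `u` with tangent directions in `T`, velocities at `u` of curves in
`N` lie in `T`. -/
lemma tangentSpaceAt_subset {N : Set V} {u : V} {T : Submodule ℝ V} [FiniteDimensional ℝ T]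
    (h : (fun v => (v - u) - T.starProjection (v - u)) =o[𝓝[N] u] fun v => v - u) :
    tangentSpaceAt N u ⊆ T := by
  rintro k ⟨γ, hγ0, hγN, -, hγ⟩
  have hcont : Filter.Tendsto γ (𝓝 0) (𝓝[N] u) := by
    refine tendsto_nhdsWithin_iff.2 ⟨?_, hγN⟩
    simpa [hγ0] using hγ.continuousAt.tendsto
  have h1 : (fun t => (γ t - u) - T.starProjection (γ t - u)) =o[𝓝 0] fun t => γ t - u :=
    h.comp_tendsto hcont
  have h2 : (fun t => γ t - u) =O[𝓝 0] fun t : ℝ => t := by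
    simpa [hγ0] using hγ.isBigO_sub
  set Q : V →L[ℝ] V := ContinuousLinearMap.id ℝ V - T.starProjection with hQ
  have h3 : HasDerivAt (fun t => Q (γ t)) (Q k) 0 := Q.hasFDerivAt.comp_hasDerivAt 0 hγ
  have h4 : HasDerivAt (fun t => Q (γ t)) 0 0 := by
    rw [hasDerivAt_iff_isLittleO]
    have := h1.trans_isBigO h2
    refine (this.congr (fun t => ?_) fun t => ?_)
    · simp [hQ, hγ0]
      abel
    · simp
  have h5 := h3.unique h4
  have h6 : k = T.starProjection k := by
    simpa [hQ, sub_eq_zero] using h5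
  rw [h6]
  exact T.starProjection_apply_mem k

open Asymptotics in
/-- A `C¹` submanifold of a finite-dimensional subspace has, at each of its points, a linear tangent
space, which approximates it to first order and onto which it projects locally surjectively. -/
theorem IsC1Submanifold.exists_tangent {E : Submodule ℝ V} [FiniteDimensional ℝ E] {d : ℕ}
    {N : Set V} (hNE : N ⊆ E) (hN : IsC1Submanifold d N) {u : V} (hu : u ∈ N) :
    ∃ (T : Submodule ℝ V) (_ : FiniteDimensional ℝ T), T ≤ E ∧ tangentSpaceAt N u = T ∧
      ((fun v => (v - u) - T.starProjection (v - u)) =o[𝓝[N] u] fun v => v - u) ∧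
      ∀ c > 0, ∃ ε > 0, ∀ h ∈ T, ‖h‖ < ε → ∃ v ∈ N, ‖v - u‖ < c ∧ T.starProjection (v - u) = h := by
  obtain ⟨W, Ω, φ, hW, huW, hΩ, hφ, hinj, hemb, himg⟩ := hN u hu
  obtain ⟨p, hp, hpu⟩ : u ∈ φ '' Ω := himg ▸ ⟨hu, huW⟩
  have hφp : ContDiffAt ℝ 1 φ p := hφ.contDiffAt (hΩ.mem_nhds hp)
  have hstrict : HasStrictFDerivAt φ (fderiv ℝ φ p) p := hφp.hasStrictFDerivAt one_ne_zero
  set L := fderiv ℝ φ p with hL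
  have hLinj : Function.Injective L := hinj p hp
  have hφN : ∀ q ∈ Ω, φ q ∈ N := fun q hq => by
    have : φ q ∈ φ '' Ω := mem_image_of_mem φ hq
    rw [himg] at this
    exact this.1
  -- Embeddedness enters here: points of `N` near `u` have parameters near `p`.
  have hlim : 𝓝[N] u = Filter.map φ (𝓝[Ω] p) := by
    rw [← nhdsWithin_inter_of_mem' (nhdsWithin_le_nhds (hW.mem_nhds huW)), ← himg, ← hpu]
    have h1 := hemb.map_nhds_eq ⟨p, hp⟩
    rw [nhdsWithin_eq_map_subtype_coe hp, Filter.map_map]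
    have h2 : range (Ω.domRestrict φ) = φ '' Ω := by
      ext x
      simp
    rw [h2] at h1
    exact h1.symm
  let T : Submodule ℝ V := LinearMap.range (L : EuclideanSpace ℝ (Fin d) →ₗ[ℝ] V)
  have hfin : FiniteDimensional ℝ T := by infer_instance
  have hLT : ∀ q, L q ∈ T := fun q => ⟨q, rfl⟩
  have hLproj : ∀ q, T.starProjection (L q) = L q := fun q =>
    Submodule.starProjection_eq_self_iff.2 (hLT q)
  have happrox : (fun v => (v - u) - T.starProjection (v - u)) =o[𝓝[N] u] fun v => v - u := by
    rw [hlim, isLittleO_map]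
    set Q : V →L[ℝ] V := ContinuousLinearMap.id ℝ V - T.starProjection with hQ
    have h1 : (fun q => φ q - φ p - L (q - p)) =o[𝓝[Ω] p] fun q => q - p :=
      (hstrict.hasFDerivAt.isLittleO).mono nhdsWithin_le_nhds
    have h2 : (fun q => Q (φ q - φ p - L (q - p))) =o[𝓝[Ω] p] fun q => q - p :=
      (Q.isBigO_comp _ _).trans_isLittleO h1
    -- Injectivity of `L` turns errors o(q - p) into errors o(φ q - φ p).
    obtain ⟨C, -, hC⟩ := L.toLinearMap.exists_antilipschitzWith (LinearMap.ker_eq_bot.2 hLinj)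
    have h3 : (fun q => q - p) =O[𝓝[Ω] p] fun q => L (q - p) := by
      refine IsBigO.of_bound C (Filter.Eventually.of_forall fun q => ?_)
      simpa [dist_eq_norm] using hC.le_mul_dist (q - p) 0
    have h4 : (fun q => q - p) =O[𝓝[Ω] p] fun q => φ q - φ p :=
      h3.trans (((h1.trans_isBigO h3).right_isBigO_add).congr_right fun q => by simp)
    refine (h2.trans_isBigO h4).congr (fun q => ?_) fun q => ?_
    · simp only [Function.comp, ← hpu]
      rw [map_sub, show Q (L (q - p)) = 0 by simp [hQ, hLproj, -map_sub]]
      simp [hQ]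
    · simp [hpu]
  refine ⟨T, hfin, ?_, Subset.antisymm (tangentSpaceAt_subset happrox) ?_, happrox, ?_⟩
  · rintro _ ⟨q, rfl⟩
    set Q : V →L[ℝ] V := ContinuousLinearMap.id ℝ V - E.starProjection with hQ
    have h1 : HasFDerivAt (fun x => Q (φ x)) (Q.comp L) p :=
      Q.hasFDerivAt.comp p hstrict.hasFDerivAt
    have h2 : HasFDerivAt (fun x => Q (φ x)) (0 : EuclideanSpace ℝ (Fin d) →L[ℝ] V) p := by
      refine (hasFDerivAt_const (0 : V) p).congr_of_eventuallyEq ?_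
      filter_upwards [hΩ.mem_nhds hp] with x hx
      have : E.starProjection (φ x) = φ x :=
        Submodule.starProjection_eq_self_iff.2 (hNE (hφN x hx))
      simp [hQ, this]
    have h3 : Q (L q) = 0 := by
      have := DFunLike.congr_fun (h1.unique h2) q
      simpa using this
    have h4 : L q = E.starProjection (L q) := by
      simpa [hQ, sub_eq_zero] using h3
    exact Submodule.starProjection_eq_self_iff.1 h4.symm
  · rintro _ ⟨q, rfl⟩
    have hline : ContDiff ℝ 1 fun t : ℝ => p + t • q := by fun_prop
    have h0 : p + (0 : ℝ) • q = p := by simp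
    refine ⟨fun t => φ (p + t • q), by simp [hpu], ?_, ?_, ?_⟩
    · have := hline.continuous.continuousAt.preimage_mem_nhds
        (show Ω ∈ 𝓝 (p + (0 : ℝ) • q) by rw [h0]; exact hΩ.mem_nhds hp)
      filter_upwards [this] with t ht using hφN _ ht
    · refine ContDiffAt.comp (0 : ℝ) (g := φ) ?_ hline.contDiffAt
      rwa [h0]
    · have h1 : HasDerivAt (fun t : ℝ => p + t • q) q 0 := by
        simpa using ((hasDerivAt_id (0 : ℝ)).smul_const q).const_add p
      have h2 : HasFDerivAt φ L (p + (0 : ℝ) • q) := by rw [h0]; exact hstrict.hasFDerivAt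
      exact h2.comp_hasDerivAt 0 h1
  · intro c hc
    -- The projected chart has surjective strict derivative, so it maps neighbourhoods of `p` onto
    -- neighbourhoods of 0 in `T`.
    have h1 : HasStrictFDerivAt (fun q => T.orthogonalProjectionOnto (φ q - u))
        (T.orthogonalProjectionOnto.comp L) p :=
      T.orthogonalProjectionOnto.hasStrictFDerivAt.comp p (hstrict.sub_const u)
    have hsurj : LinearMap.range (T.orthogonalProjectionOnto.comp L : _ →L[ℝ] T).toLinearMap = ⊤ := by
      rw [LinearMap.range_eq_top]
      rintro ⟨_, q, rfl⟩
      refine ⟨q, Subtype.ext ?_⟩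
      exact hLproj q
    have h2 := h1.map_nhds_eq_of_surj hsurj
    have h3 : Ω ∩ {q | ‖φ q - u‖ < c} ∈ 𝓝 p := by
      refine Filter.inter_mem (hΩ.mem_nhds hp) ?_
      have : ContinuousAt (fun q => ‖φ q - u‖) p := (hφp.continuousAt.sub_const u).norm
      refine this.eventually_lt continuousAt_const ?_
      simpa [hpu] using hc
    have h4 := Filter.image_mem_map (m := fun q => T.orthogonalProjectionOnto (φ q - u)) h3
    rw [h2, hpu, sub_self, map_zero, Metric.mem_nhds_iff] at h4
    obtain ⟨ε, hε, hball⟩ := h4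
    refine ⟨ε, hε, fun h hh hlt => ?_⟩
    obtain ⟨q, ⟨hqΩ, hqc⟩, hq⟩ := hball (show (⟨h, hh⟩ : T) ∈ Metric.ball 0 ε by simpa using hlt)
    exact ⟨φ q, hφN q hqΩ, hqc, congrArg Subtype.val hq⟩

end TangentSpace

/-! ### Tangent balls and the quadratic bound. -/

section LocalReach

variable {V : Type*} [NormedAddCommGroup V]

lemma ball_subset_of_lt_localReach {N : Set V} {u : V} {ρ : ℝ}
    (h : ENNReal.ofReal ρ < localReach N u) : Metric.ball u ρ ⊆ bestApproxDomain N := by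
  obtain ⟨_, ⟨r, rfl, hr⟩, hlt⟩ := lt_sSup_iff.1 h
  refine (Metric.ball_subset_ball ?_).trans hr
  exact Real.toNNReal_le_iff_le_coe.1 (ENNReal.coe_lt_coe.1 hlt).le

variable [InnerProductSpace ℝ V]

/-- Compactness of closed balls fails in a general `V`, so the principle is applied in the
finite-dimensional `E`, where the points of `N` and their distances are unchanged. -/
lemma IsNearest.add_smul_of_subset {E : Submodule ℝ V} [FiniteDimensional ℝ E] {N : Set V}
    (hNE : N ⊆ E) {u x p : V} {ρ s : ℝ} (hu : u ∈ E) (hxE : x ∈ E)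
    (hN : Metric.ball u ρ ⊆ bestApproxDomain N) (hs : 0 ≤ s)
    (hx : ‖x - u‖ + s < ρ) (hp : IsNearest N x p) (hxp : x ≠ p) :
    IsNearest N (x + s • ‖x - p‖⁻¹ • (x - p)) p := by
  let A : Set E := {a | (a : V) ∈ N}
  have hnear : ∀ a b : E, IsNearest A a b ↔ IsNearest N (a : V) (b : V) := by
    intro a b
    refine and_congr_right fun _ => ⟨fun h c hc => h ⟨c, hNE hc⟩ hc, fun h c hc => h c hc⟩
  have hA : Metric.ball (⟨u, hu⟩ : E) ρ ⊆ bestApproxDomain A := by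
    intro y hy
    obtain ⟨q, hq, huniq⟩ := hN (show (y : V) ∈ Metric.ball u ρ from hy)
    refine ⟨⟨q, hNE hq.1⟩, (hnear y ⟨q, hNE hq.1⟩).2 hq, fun q' hq' => Subtype.ext ?_⟩
    exact huniq q' ((hnear y q').1 hq')
  have hsub : Metric.closedBall (⟨x, hxE⟩ : E) s ⊆ Metric.ball ⟨u, hu⟩ ρ := by
    refine Metric.closedBall_subset_ball' ?_
    rw [Subtype.dist_eq, dist_eq_norm]
    simpa [add_comm] using hx
  have hne : (⟨x, hxE⟩ : E) ≠ ⟨p, hNE hp.1⟩ := fun h => hxp (congrArg Subtype.val h)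
  exact (hnear _ _).1 (((hnear ⟨x, hxE⟩ ⟨p, hNE hp.1⟩).2 hp).add_smul hA hs hsub hne)

/-- Balls inside the reach that touch `N` at `u` in a normal direction contain no point of `N`. -/
theorem le_norm_add_smul_sub {E : Submodule ℝ V} [FiniteDimensional ℝ E] {N : Set V}
    (hNE : N ⊆ E) {u : V} (hu : u ∈ N) {ρ s : ℝ} (hs : 0 ≤ s) (hsρ : s < ρ)
    (hN : Metric.ball u ρ ⊆ bestApproxDomain N) {T : Submodule ℝ V} [FiniteDimensional ℝ T]
    (happrox : (fun v => (v - u) - T.starProjection (v - u)) =o[𝓝[N] u] fun v => v - u)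
    {n : V} (hnE : n ∈ E) (hn : ‖n‖ = 1) (hnT : ∀ k ∈ T, inner ℝ n k = 0) {b : V} (hb : b ∈ N) :
    s ≤ ‖u + s • n - b‖ := by
  choose! P hP using fun x (hx : x ∈ Metric.ball u ρ) => (hN hx).exists
  have hP : ∀ x ∈ Metric.ball u ρ, IsNearest N x (P x) := hP
  have hsmall : ∀ᶠ ε in 𝓝[>] (0 : ℝ), 0 < ε ∧ ε + s < ρ := by
    filter_upwards [self_mem_nhdsWithin,
      nhdsWithin_le_nhds (Iio_mem_nhds (show (0 : ℝ) < ρ - s by linarith))] with ε h0 h1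
    have h1 : ε < ρ - s := h1
    exact ⟨h0, by linarith⟩
  have hnear : ∀ ε : ℝ, 0 < ε → ε + s < ρ → IsNearest N (u + ε • n) (P (u + ε • n)) := by
    intro ε h0 h1
    apply hP
    rw [Metric.mem_ball, dist_eq_norm, add_sub_cancel_left, norm_smul, hn,
      Real.norm_of_nonneg h0.le]
    linarith
  have hnorm : ∀ ε : ℝ, 0 < ε → ε + s < ρ → ‖u + ε • n - P (u + ε • n)‖ ≤ ε := by
    intro ε h0 h1
    have := (hnear ε h0 h1).2 u hu
    rwa [add_sub_cancel_left, norm_smul, hn, Real.norm_of_nonneg h0.le, mul_one] at this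
  have hε : Filter.Tendsto (fun ε : ℝ => ε) (𝓝[>] 0) (𝓝 0) :=
    Filter.tendsto_id.mono_left nhdsWithin_le_nhds
  have hPlim : Filter.Tendsto (fun ε : ℝ => P (u + ε • n)) (𝓝[>] 0) (𝓝[N] u) := by
    refine tendsto_nhdsWithin_iff.2 ⟨?_, hsmall.mono fun ε h => (hnear ε h.1 h.2).1⟩
    rw [tendsto_iff_norm_sub_tendsto_zero]
    have h2 : Filter.Tendsto (fun ε : ℝ => 2 * ε) (𝓝[>] 0) (𝓝 0) := by
      simpa using hε.const_mul 2
    refine squeeze_zero' (Filter.Eventually.of_forall fun _ => norm_nonneg _) ?_ h2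
    filter_upwards [hsmall] with ε h
    have h3 : P (u + ε • n) - u = ε • n - (u + ε • n - P (u + ε • n)) := by abel
    have h4 := norm_sub_le (ε • n) (u + ε • n - P (u + ε • n))
    rw [h3]
    rw [norm_smul, hn, Real.norm_of_nonneg h.1.le] at h4
    linarith [hnorm ε h.1 h.2]
  set w : ℝ → V := fun ε => ε⁻¹ • (P (u + ε • n) - u) with hw
  have hwlim : Filter.Tendsto w (𝓝[>] 0) (𝓝 0) := by
    rw [Metric.tendsto_nhds]
    intro η hη
    filter_upwards [hsmall, (happrox.comp_tendsto hPlim).bound (show 0 < η / 4 by positivity)]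
      with ε ⟨h0, h1⟩ h2
    simp only [Function.comp] at h2
    set e := P (u + ε • n) - u with he
    have h3 : ‖ε • n - e‖ ≤ ε := by
      have : ε • n - e = u + ε • n - P (u + ε • n) := by rw [he]; abel
      rw [this]
      exact hnorm ε h0 h1
    -- `P (u + ε • n)` is at least as near as `u`. As `n` is normal to `T`, `inner ℝ n e` is o(‖e‖),
    -- so together ‖e‖ = o(ε).
    have h4 : ‖e‖ ^ 2 ≤ 2 * ε * inner ℝ n e := by
      have h5 : ‖ε • n - e‖ ^ 2 ≤ ε ^ 2 := by gcongr
      rw [norm_sub_sq_real, norm_smul, hn, real_inner_smul_left, mul_one, Real.norm_eq_abs,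
        sq_abs] at h5
      linarith
    have h6 : inner ℝ n e ≤ η / 4 * ‖e‖ := by
      have h7 : inner ℝ n e = inner ℝ n (e - T.starProjection e) := by
        rw [inner_sub_right n e, hnT _ (T.starProjection_apply_mem e), sub_zero]
      rw [h7]
      refine (real_inner_le_norm _ _).trans ?_
      rwa [hn, one_mul]
    have h8 : ‖e‖ ≤ η / 2 * ε := by
      rcases (norm_nonneg e).eq_or_lt with h | h
      · rw [← h]; positivity
      · have : ‖e‖ * ‖e‖ ≤ (η / 2 * ε) * ‖e‖ := by
          have := mul_le_mul_of_nonneg_left h6 (show 0 ≤ 2 * ε by positivity)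
          nlinarith
        exact le_of_mul_le_mul_right this h
    rw [dist_zero_right, hw]
    simp only
    rw [norm_smul, norm_inv, Real.norm_of_nonneg h0.le]
    calc ε⁻¹ * ‖e‖ ≤ ε⁻¹ * (η / 2 * ε) := by gcongr
      _ = η / 2 := by field_simp
      _ < η := by linarith
  have hnw : Filter.Tendsto (fun ε => n - w ε) (𝓝[>] 0) (𝓝 n) := by
    simpa using hwlim.const_sub n
  have hy : Filter.Tendsto (fun ε : ℝ => u + ε • n + s • ‖n - w ε‖⁻¹ • (n - w ε)) (𝓝[>] 0)
      (𝓝 (u + s • n)) := by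
    have h1 := ((hnw.norm.inv₀ (by rw [hn]; exact one_ne_zero)).smul hnw).const_smul s
    have h2 := ((hε.smul_const n).const_add u).add h1
    simpa [hn] using h2
  have hPu : Filter.Tendsto (fun ε : ℝ => P (u + ε • n)) (𝓝[>] 0) (𝓝 u) :=
    hPlim.mono_right nhdsWithin_le_nhds
  have hkey : ∀ᶠ ε in 𝓝[>] (0 : ℝ),
      ‖u + ε • n + s • ‖n - w ε‖⁻¹ • (n - w ε) - P (u + ε • n)‖ ≤
        ‖u + ε • n + s • ‖n - w ε‖⁻¹ • (n - w ε) - b‖ := by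
    have hne : ∀ᶠ ε in 𝓝[>] (0 : ℝ), n - w ε ≠ 0 :=
      hnw.eventually_ne (norm_ne_zero_iff.1 (by rw [hn]; exact one_ne_zero))
    filter_upwards [hsmall, hne] with ε ⟨h0, h1⟩ h2
    have h3 : u + ε • n - P (u + ε • n) = ε • (n - w ε) := by
      rw [smul_sub, hw]
      simp only
      rw [smul_inv_smul₀ h0.ne']
      abel
    have h4 : u + ε • n ≠ P (u + ε • n) := by
      rw [← sub_ne_zero, h3]
      exact smul_ne_zero h0.ne' h2
    have h5 : ‖u + ε • n - u‖ + s < ρ := by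
      rwa [add_sub_cancel_left, norm_smul, hn, Real.norm_of_nonneg h0.le, mul_one]
    have h6 := ((hnear ε h0 h1).add_smul_of_subset hNE (hNE hu)
      (E.add_mem (hNE hu) (E.smul_mem ε hnE)) hN hs h5 h4).2 b hb
    have h7 : ‖ε • (n - w ε)‖⁻¹ • ε • (n - w ε) = ‖n - w ε‖⁻¹ • (n - w ε) := by
      rw [norm_smul, Real.norm_of_nonneg h0.le, smul_smul, mul_inv, mul_right_comm,
        inv_mul_cancel₀ h0.ne', one_mul]
    rwa [h3, h7] at h6
  have := le_of_tendsto_of_tendsto (hy.sub hPu).norm (hy.sub_const b).norm hkey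
  rwa [add_sub_cancel_left, norm_smul, hn, Real.norm_of_nonneg hs, mul_one] at this

/-- Points of `N` lie quadratically close to the tangent space, with constant given by the reach. -/
theorem two_mul_norm_sub_starProjection_le {E : Submodule ℝ V} [FiniteDimensional ℝ E] {N : Set V}
    (hNE : N ⊆ E) {u : V} (hu : u ∈ N) {s : ℝ} (hs : 0 ≤ s)
    (hsR : ENNReal.ofReal s < localReach N u) {T : Submodule ℝ V} [FiniteDimensional ℝ T]
    (hTE : T ≤ E)
    (happrox : (fun v => (v - u) - T.starProjection (v - u)) =o[𝓝[N] u] fun v => v - u)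
    {b : V} (hb : b ∈ N) :
    2 * s * ‖(b - u) - T.starProjection (b - u)‖ ≤ ‖b - u‖ ^ 2 := by
  set k := (b - u) - T.starProjection (b - u) with hk
  rcases eq_or_ne k 0 with h0 | h0
  · rw [h0]; simp
  have hkT : ∀ t ∈ T, inner ℝ k t = 0 := fun t ht => T.starProjection_inner_eq_zero _ t ht
  have hk0 : ‖k‖ ≠ 0 := norm_ne_zero_iff.2 h0
  have hkE : k ∈ E := E.sub_mem (E.sub_mem (hNE hb) (hNE hu)) (hTE (T.starProjection_apply_mem _))
  obtain ⟨ρ', hρ1, hρ2⟩ := ENNReal.lt_iff_exists_nnreal_btwn.1 hsR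
  have hsρ : s < ρ' := by
    rw [ENNReal.ofReal, ENNReal.coe_lt_coe] at hρ1
    exact (Real.toNNReal_lt_iff_lt_coe hs).1 hρ1
  have h1 := le_norm_add_smul_sub hNE hu hs hsρ
    (ball_subset_of_lt_localReach (by rwa [ENNReal.ofReal_coe_nnreal])) happrox
    (n := ‖k‖⁻¹ • k) (E.smul_mem _ hkE)
    (by rw [norm_smul, norm_inv, norm_norm, inv_mul_cancel₀ hk0])
    (fun t ht => by rw [real_inner_smul_left, hkT t ht, mul_zero]) hb
  have h2 : inner ℝ k (b - u) = ‖k‖ ^ 2 := by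
    have : b - u = k + T.starProjection (b - u) := by rw [hk]; abel
    rw [this, inner_add_right, hkT _ (T.starProjection_apply_mem _), real_inner_self_eq_norm_sq,
      add_zero]
  have h3 : ‖u + s • ‖k‖⁻¹ • k - b‖ ^ 2 = s ^ 2 - 2 * s * ‖k‖ + ‖b - u‖ ^ 2 := by
    have : u + s • ‖k‖⁻¹ • k - b = s • ‖k‖⁻¹ • k - (b - u) := by abel
    rw [this, norm_sub_sq_real, real_inner_smul_left, real_inner_smul_left, h2, norm_smul,
      norm_smul, norm_inv, norm_norm, inv_mul_cancel₀ hk0, mul_one, Real.norm_of_nonneg hs]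
    field_simp
  have h4 : s ^ 2 ≤ ‖u + s • ‖k‖⁻¹ • k - b‖ ^ 2 := by gcongr
  linarith

end LocalReach

/-! ### Planar estimate and the two statements. -/

/-- A height `g ≤ 1` over the abscissa `(1 - y ^ 2 / 2) * y` lying outside the unit ball centred
at height `1` is close to the point `y` of the axis. -/
lemma sq_add_sq_le_of_two_mul_le {y g : ℝ} (hy0 : 0 ≤ y) (hy : y ≤ 1 / 2) (hg0 : 0 ≤ g)
    (hg1 : g ≤ 1) (h : 2 * g ≤ ((1 - y ^ 2 / 2) * y) ^ 2 + g ^ 2) :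
    (y ^ 2 / 2 * y) ^ 2 + g ^ 2 ≤ (y ^ 2 / 2) ^ 2 ∧ ((1 - y ^ 2 / 2) * y) ^ 2 + g ^ 2 ≤ y ^ 2 := by
  obtain ⟨x, hx⟩ : ∃ x, x = y ^ 2 := ⟨_, rfl⟩
  have hx0 : 0 ≤ x := hx ▸ sq_nonneg y
  have hx1 : x ≤ 1 / 4 := by nlinarith
  have ha : ((1 - y ^ 2 / 2) * y) ^ 2 = x - x ^ 2 + x ^ 3 / 4 := by rw [hx]; ring
  have hb : (y ^ 2 / 2 * y) ^ 2 = x ^ 3 / 4 := by rw [hx]; ring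
  rw [ha] at h
  rw [ha, hb, ← hx]
  -- `G` bounds the height: 2g - g² increases on [0, 1] and at `G` is at least x - x² + x³/4. The
  -- factor 3/5 also keeps G² ≤ x²/4 - x³/4, which is what the first conclusion needs.
  set G := x / 2 * (1 - 3 * x / 5) with hG
  have hG0 : 0 ≤ G := mul_nonneg (by linarith) (by linarith)
  have hx3 : 0 ≤ x ^ 2 * (1 / 4 - x) := mul_nonneg (sq_nonneg x) (by linarith)
  have hG2 : G ^ 2 ≤ x ^ 2 / 4 * (1 - x) := by
    have : G ^ 2 = x ^ 2 / 4 * (1 - 6 * x / 5 + 9 * x ^ 2 / 25) := by rw [hG]; ring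
    rw [this]
    refine mul_le_mul_of_nonneg_left ?_ (by positivity)
    nlinarith
  have hgG : g ≤ G := by
    by_contra! hlt
    have hG1 : G < 1 := hlt.trans_le hg1
    have h1 : 0 < (g - G) * (2 - g - G) := mul_pos (by linarith) (by linarith)
    have h2 : 2 * G - G ^ 2 < x - x ^ 2 + x ^ 3 / 4 := by nlinarith
    have h3 : 2 * G = x - 3 * x ^ 2 / 5 := by rw [hG]; ring
    nlinarith
  have hg2 : g ^ 2 ≤ G ^ 2 := by gcongr
  constructor <;> nlinarith

theorem proposition1 {V : Type*} [NormedAddCommGroup V] [InnerProductSpace ℝ V]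
    (E : Submodule ℝ V) [FiniteDimensional ℝ E]
    (d : ℕ) (N : Set V) (hNE : N ⊆ E) (hN : IsC1Submanifold d N)
    (u : V) (hu : u ∈ N) (R : ℝ≥0∞) (hR : R = localReach N u) (hRpos : 0 < R) :
    ∃ rstar : ℝ, 0 < rstar ∧ ENNReal.ofReal rstar ≤ R ∧
      (∀ r : ℝ, 0 < r → ∀ v ∈ N ∩ Metric.ball u r,
        ∃ w ∈ affineTangentSpaceAt N u ∩ Metric.ball u r,
          ENNReal.ofReal ‖v - w‖ ≤ ENNReal.ofReal (‖u - v‖ ^ 2) / (2 * R)) ∧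
      (∀ r : ℝ, 0 < r → r < rstar → ∀ w ∈ affineTangentSpaceAt N u ∩ Metric.ball u r,
        ∃ v ∈ N ∩ Metric.ball u r,
          ENNReal.ofReal ‖w - v‖ ≤ ENNReal.ofReal (‖u - w‖ ^ 2) / (2 * R)) := by
  subst hR
  obtain ⟨T, _, hTE, hT, happrox, hsurj⟩ := hN.exists_tangent hNE hu
  have hball : ∀ {r : ℝ} {h : V}, u + h ∈ Metric.ball u r ↔ ‖h‖ < r := by
    intro r h
    rw [Metric.mem_ball, dist_eq_norm, add_sub_cancel_left]
  have haff : ∀ {w : V}, w ∈ affineTangentSpaceAt N u ↔ ∃ h ∈ T, u + h = w := by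
    intro w
    rw [affineTangentSpaceAt, hT]
    rfl
  have hquad : ∀ v ∈ N, ∀ s : ℝ, 0 ≤ s → ENNReal.ofReal s < localReach N u →
      2 * s * ‖(v - u) - T.starProjection (v - u)‖ ≤ ‖v - u‖ ^ 2 := fun v hv s hs hsR =>
    two_mul_norm_sub_starProjection_le hNE hu hs hsR hTE happrox hv
  have hproj : ∀ v ∈ N, ∀ r : ℝ, v ∈ Metric.ball u r →
      u + T.starProjection (v - u) ∈ affineTangentSpaceAt N u ∩ Metric.ball u r := by
    intro v _ r hvr
    rw [Metric.mem_ball, dist_eq_norm] at hvr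
    exact ⟨haff.2 ⟨_, T.starProjection_apply_mem _, rfl⟩,
      hball.2 ((T.norm_starProjection_apply_le _).trans_lt hvr)⟩
  rcases eq_or_ne (localReach N u) ⊤ with htop | htop
  · have hzero : ∀ v ∈ N, u + T.starProjection (v - u) = v := by
      intro v hv
      set k := (v - u) - T.starProjection (v - u) with hk
      have hk0 : ‖k‖ = 0 := by
        by_contra hne
        have hpos : 0 < ‖k‖ := lt_of_le_of_ne (norm_nonneg _) (Ne.symm hne)
        -- With infinite reach any radius is allowed; this one contradicts the bound.
        have h1 := hquad v hv (‖v - u‖ ^ 2 / ‖k‖ + 1) (by positivity)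
          (by rw [htop]; exact ENNReal.ofReal_lt_top)
        rw [← hk] at h1
        have h2 : 2 * (‖v - u‖ ^ 2 / ‖k‖ + 1) * ‖k‖ = 2 * ‖v - u‖ ^ 2 + 2 * ‖k‖ := by
          field_simp
        have := sq_nonneg ‖v - u‖
        linarith
      rw [norm_eq_zero, hk, sub_eq_zero] at hk0
      rw [← hk0]
      abel
    obtain ⟨ε, hε, hεN⟩ := hsurj 1 one_pos
    refine ⟨ε, hε, by rw [htop]; exact le_top, fun r _ v ⟨hv, hvr⟩ => ⟨_, hproj v hv r hvr, ?_⟩,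
      fun r _ hrε w ⟨hw, hwr⟩ => ?_⟩
    · rw [hzero v hv]
      simp
    · obtain ⟨h, hh, rfl⟩ := haff.1 hw
      obtain ⟨v, hv, -, hvh⟩ := hεN h hh ((hball.1 hwr).trans hrε)
      have hvu : v = u + h := by rw [← hvh, hzero v hv]
      exact ⟨v, ⟨hv, hvu ▸ hwr⟩, by simp [hvu]⟩
  · obtain ⟨ρ, hρ⟩ : ∃ ρ : ℝ, ρ = (localReach N u).toReal := ⟨_, rfl⟩
    have hρ0 : 0 < ρ := hρ ▸ ENNReal.toReal_pos hRpos.ne' htop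
    have hρR : localReach N u = ENNReal.ofReal ρ := by rw [hρ, ENNReal.ofReal_toReal htop]
    have hquad' : ∀ v ∈ N, 2 * ρ * ‖(v - u) - T.starProjection (v - u)‖ ≤ ‖v - u‖ ^ 2 := by
      intro v hv
      have hc : Continuous fun s : ℝ => 2 * s * ‖(v - u) - T.starProjection (v - u)‖ := by
        fun_prop
      refine le_of_tendsto ((hc.tendsto ρ).mono_left (nhdsWithin_le_nhds (s := Iio ρ))) ?_
      filter_upwards [self_mem_nhdsWithin, nhdsWithin_le_nhds (Ioi_mem_nhds hρ0)] with s h1 h0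
      refine hquad v hv s (le_of_lt h0) ?_
      rw [hρR]
      exact (ENNReal.ofReal_lt_ofReal_iff hρ0).2 h1
    have hdiv : ∀ x : ℝ, ENNReal.ofReal x / (2 * localReach N u) =
        ENNReal.ofReal (x / (2 * ρ)) := by
      intro x
      rw [ENNReal.ofReal_div_of_pos (by positivity), ENNReal.ofReal_mul two_pos.le, hρR]
      simp
    simp only [hdiv]
    -- Requiring ‖v - u‖ < `ρ` keeps `v` below the centre of the tangent ball (`g ≤ 1`), excluding
    -- the far side of the sphere. The bound `ρ / 2` on the radius gives `y ≤ 1 / 2`.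
    obtain ⟨ε, hε, hεN⟩ := hsurj ρ hρ0
    refine ⟨min ε (ρ / 2), lt_min hε (half_pos hρ0), ?_,
      fun r _ v ⟨hv, hvr⟩ => ⟨_, hproj v hv r hvr, ?_⟩, fun r _ hrε w ⟨hw, hwr⟩ => ?_⟩
    · rw [hρR]
      exact ENNReal.ofReal_le_ofReal ((min_le_right _ _).trans (by linarith))
    · refine ENNReal.ofReal_le_ofReal ?_
      rw [le_div_iff₀ (by positivity), ← sub_sub, norm_sub_rev u v]
      linarith [hquad' v hv]
    · obtain ⟨h, hh, rfl⟩ := haff.1 hw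
      have hhr := hball.1 hwr
      obtain ⟨y, hy⟩ : ∃ y, y = ‖h‖ / ρ := ⟨_, rfl⟩
      have hhy : ‖h‖ = y * ρ := by rw [hy]; field_simp
      have hy0 : 0 ≤ y := hy ▸ by positivity
      have hhρ : ‖h‖ < ρ / 2 := hhr.trans (hrε.trans_le (min_le_right _ _))
      have hy2 : y ≤ 1 / 2 := by
        rw [hy, div_le_iff₀ hρ0]
        linarith
      have hs0 : 0 ≤ 1 - y ^ 2 / 2 := by nlinarith
      -- Over `h` itself, a point on the tangent sphere has scaled height 1 - √(1 - y²), which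
      -- exceeds y²/2 for y > 0. Shortening `h` lowers this at only a third-order horizontal cost.
      obtain ⟨v, hv, hvρ, hvh⟩ := hεN ((1 - y ^ 2 / 2) • h) (T.smul_mem _ hh) (by
        rw [norm_smul, Real.norm_of_nonneg hs0]
        have := hhr.trans (hrε.trans_le (min_le_left _ _))
        nlinarith [norm_nonneg h, sq_nonneg y])
      have hvq := hquad' v hv
      rw [hvh] at hvq
      set k := (v - u) - (1 - y ^ 2 / 2) • h with hk
      have hkh : inner ℝ h k = 0 := by
        rw [real_inner_comm, hk, ← hvh]
        exact T.starProjection_inner_eq_zero _ _ hh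
      have hvk : ‖v - u‖ ^ 2 = ((1 - y ^ 2 / 2) * ‖h‖) ^ 2 + ‖k‖ ^ 2 := by
        have : v - u = (1 - y ^ 2 / 2) • h + k := by rw [hk]; abel
        rw [this, norm_add_sq_real, real_inner_smul_left, hkh, norm_smul,
          Real.norm_of_nonneg hs0]
        ring
      have hwk : ‖u + h - v‖ ^ 2 = (y ^ 2 / 2 * ‖h‖) ^ 2 + ‖k‖ ^ 2 := by
        have : u + h - v = (y ^ 2 / 2) • h - k := by rw [hk]; module
        rw [this, norm_sub_sq_real, real_inner_smul_left, hkh, norm_smul,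
          Real.norm_of_nonneg (by positivity)]
        ring
      obtain ⟨g, hg⟩ : ∃ g, g = ‖k‖ / ρ := ⟨_, rfl⟩
      have hkg : ‖k‖ = g * ρ := by rw [hg]; field_simp
      have hg0 : 0 ≤ g := hg ▸ by positivity
      have hkv : ‖k‖ ≤ ‖v - u‖ :=
        (abs_le_of_sq_le_sq' (by rw [hvk]; exact le_add_of_nonneg_left (sq_nonneg _))
          (norm_nonneg _)).2
      have hg1 : g ≤ 1 := by
        rw [hg, div_le_one hρ0]
        linarith
      rw [hvk, hkg, hhy] at hvq
      rw [hkg, hhy] at hvk hwk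
      have hgy : 2 * g ≤ ((1 - y ^ 2 / 2) * y) ^ 2 + g ^ 2 := by
        have : ρ ^ 2 * (2 * g) ≤ ρ ^ 2 * (((1 - y ^ 2 / 2) * y) ^ 2 + g ^ 2) := by linarith
        exact le_of_mul_le_mul_left this (by positivity)
      obtain ⟨h1, h2⟩ := sq_add_sq_le_of_two_mul_le hy0 hy2 hg0 hg1 hgy
      refine ⟨v, ⟨hv, ?_⟩, ?_⟩
      · rw [Metric.mem_ball, dist_eq_norm]
        refine lt_of_le_of_lt (abs_le_of_sq_le_sq' ?_ (norm_nonneg h)).2 hhr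
        rw [hvk, hhy]
        have := mul_le_mul_of_nonneg_left h2 (sq_nonneg ρ)
        linarith
      · refine ENNReal.ofReal_le_ofReal (abs_le_of_sq_le_sq' ?_ (by positivity)).2
        rw [sub_add_cancel_left, norm_neg, hwk, hhy]
        have : ((y * ρ) ^ 2 / (2 * ρ)) ^ 2 = ρ ^ 2 * (y ^ 2 / 2) ^ 2 := by field_simp
        rw [this]
        have := mul_le_mul_of_nonneg_left h1 (sq_nonneg ρ)
        linarith
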